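/- **Setting.** Let $G=(V,E)$ be a connected, locally finite graph, let $\Gamma$ be a closed, transitive, unimodular subgroup of $\mathrm{Aut}(G)$ (with the topology of pointwise convergence; unimodular means that the left Haar measure of $\Gamma$ is also right invariant), and let $d$ be a $\Gamma$-invariant metric on $V$. Fix $o\in V$ and $r>0$. Write $D_x(s)=\{y\in V: d(y,x)\le s\}$, $\operatorname{diam}(A;x)=\sup\{d(v,x):v\in A\}\in[-\infty,\infty]$ and $\operatorname{diam}(A)=\operatorname{diam}(A;o)$. A percolation is a probability measure $\mu$ on the subgraphs of $G$; $\mathfrak C_x$ denotes the vertex set of the connected component of $x$ in the random subgraph (empty if $x$ is not one of its vertices), which is written $\mathfrak T_x$ if the subgraph is a.s. a spanning forest. An infinite tree has one end if any two infinite self-avoiding paths in it have a finite symmetric difference. In a forest with one-ended components, $\mathrm{past}_x$ is the set of vertices $y$ such that the unique infinite self-avoiding path starting at $y$ contains $x$. For $o\in V$, $\mathsf{WSF}_o$ (the wired spanning forest with $o$ wired to infinity) is the weak limit, as the finite sets $K$ increase to $V$, of the uniform measures on the spanning trees of the multigraph obtained from $G$ by identifying $o$ and all the vertices outside $K$ to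 a single vertex and deleting loops; these trees are viewed as sets of edges of $G$, that is, as subgraphs of $G$ with vertex set $V$. Conventions: $1/\infty=0$, $0/0=0$ and $a/\infty = 0$ for finite $a$; a term $\mu(A)\,\mathbf E_\mu[\,\cdot\mid A]$ with $\mu(A)=0$ is $0$. **Theorem 1.3.** (i) Let $\mu$ be a $\Gamma$-invariant percolation that is supported on spanning forests with one-ended components. Then $$\mu\big(\operatorname{diam}(\mathrm{past}_o)>r\big)\ \ge \sum_{x\in V:\ r<d(x,o)\le 2r}\frac{\mu(o\in \mathrm{past}_x)^2}{\mathbf E_\mu\big[\,|\mathfrak T_o\cap D_o(4r)|\,\mathbf 1_{o\in \mathrm{past}_x}\big]}.$$ For (ii) and (iii) suppose that no edge of $G$ joins a vertex of $D_o(r)$ to a vertex outside $D_o(4r)$ (for the graph metric this holds for all $r\ge 1/4$). (ii) Suppose that $D_o(4r)$ is finite. Let $\mu$ be a $\Gamma$-invariant percolation. Then $$\mu\big(\operatorname{diam}(\mathfrak C_o)>4r\big)=\sum_{x\in V:\ r<d(x,o)\le 4r}\mu(o\in\mathfrak C_x)\;\mathbf E_\mu\bigg[\frac{\mathbf 1_{\operatorname{diam}(\mathfrak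 C_x;x)>4r}}{|\mathfrak C_x\cap D_x(4r)\setminus D_x(r)|}\,\bigg|\,o\in\mathfrak C_x\bigg].$$ (iii) Suppose that $\mathsf{WSF}_o(|\mathfrak T_o|<\infty)=1$. Then $$\mathsf{WSF}_o\big(\operatorname{diam}(\mathfrak T_o)>4r\big)=\sum_{x\in V:\ r<d(x,o)\le 4r}\mathsf{WSF}_x(o\in\mathfrak T_x)\;\mathbf E_{\mathsf{WSF}_x}\bigg[\frac{\mathbf 1_{\operatorname{diam}(\mathfrak T_x;x)>4r}}{|\mathfrak T_x\cap D_x(4r)\setminus D_x(r)|}\,\bigg|\,o\in\mathfrak T_x\bigg].$$ -/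

import Mathlib

open MeasureTheory ProbabilityTheory Filter Topology Set
open scoped ENNReal

namespace Percolation

universe u

variable {V : Type u} {G : SimpleGraph V}

/-! ### Automorphism groups -/

/-- The topology of pointwise convergence on the automorphism group of a graph (the vertex set is
discrete). -/
instance autTopology (G : SimpleGraph V) : TopologicalSpace (G ≃g G) :=
  TopologicalSpace.induced (fun γ : G ≃g G => (γ : V → V))
    (@Pi.topologicalSpace V (fun _ => V) (fun _ => ⊥))

/-- A topological group is unimodular if its (left) Haar measure, a Borel measure, is also
invariant under right multiplication. -/
def IsUnimodularGroup (Γ : Type*) [Group Γ] [TopologicalSpace Γ] : Prop :=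
  letI : MeasurableSpace Γ := borel Γ
  ∃ ν : Measure Γ, ν.IsHaarMeasure ∧ ν.IsMulRightInvariant

/-- The subgroup `Γ` of `Aut(G)` acts transitively on the vertices. -/
def IsTransitive (Γ : Subgroup (G ≃g G)) : Prop :=
  ∀ x y : V, ∃ γ ∈ Γ, γ x = y

/-! ### Percolation: measures on the space of subgraphs -/

/-- The product σ-algebra on the space of subgraphs of `G`: it is generated by the events that
a given vertex is present and that a given edge is present. -/
instance subgraphMeasurableSpace (G : SimpleGraph V) : MeasurableSpace G.Subgraph :=
  MeasurableSpace.generateFrom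
    ({A | ∃ x : V, A = {H : G.Subgraph | x ∈ H.verts}} ∪
      {A | ∃ x y : V, A = {H : G.Subgraph | H.Adj x y}})

/-- Invariance of a percolation under all automorphisms in `Γ`. -/
def IsInvariant (Γ : Subgroup (G ≃g G)) (μ : Measure G.Subgraph) : Prop :=
  ∀ γ ∈ Γ, μ.map (fun H : G.Subgraph => H.map γ.toHom) = μ

/-- The vertex set of the connected component of `x` in `H` (empty if `x` is not a vertex
of `H`). -/
def cluster (H : G.Subgraph) (x : V) : Set V :=
  {y | x ∈ H.verts ∧ H.spanningCoe.Reachable x y}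

/-- `p` is an infinite self-avoiding path in `H`. -/
def IsRay (H : G.Subgraph) (p : ℕ → V) : Prop :=
  Function.Injective p ∧ ∀ n, H.Adj (p n) (p (n + 1))

/-- The component of `x` in `H` is infinite, and any two infinite self-avoiding paths in it have
a finite symmetric difference. -/
def IsOneEnded (H : G.Subgraph) (x : V) : Prop :=
  (cluster H x).Infinite ∧
    ∀ p q : ℕ → V, IsRay H p → IsRay H q → p 0 ∈ cluster H x → q 0 ∈ cluster H x →
      (symmDiff (range p) (range q)).Finite

/-- `H` is a spanning forest of `G`, each of whose components (trees) has one end. -/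
def IsOneEndedSpanningForest (H : G.Subgraph) : Prop :=
  H.IsSpanning ∧ H.spanningCoe.IsAcyclic ∧ ∀ x : V, IsOneEnded H x

/-- The past of `x`: the vertices `y` such that the infinite self-avoiding path of `H` that starts
at `y` contains `x`. In a forest with one-ended components that path exists and is unique, for
every `y`. -/
def past (H : G.Subgraph) (x : V) : Set V :=
  {y | ∃ p : ℕ → V, IsRay H p ∧ p 0 = y ∧ x ∈ range p}

/-! ### Distances -/

/-- `diam(A; x) = sup {d(v, x) : v ∈ A}`, possibly infinite. -/
noncomputable def diamFrom [MetricSpace V] (A : Set V) (x : V) : EReal :=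
  ⨆ v ∈ A, ((dist v x : ℝ) : EReal)

/-- The number of elements of a set, possibly infinite. -/
noncomputable def size (A : Set V) : ℝ≥0∞ := ((A.encard : ℕ∞) : ℝ≥0∞)

/-- The random variable `𝟏[diam(C_x; x) > 4r] / |C_x ∩ D_x(4r) \ D_x(r)|`, where `C_x` is the
component of `x` in `H` and `D_x(s)` is the closed ball of radius `s` about `x`. -/
noncomputable def annulusRatio [MetricSpace V] (r : ℝ) (x : V) (H : G.Subgraph) : ℝ≥0∞ :=
  {H : G.Subgraph | ((4 * r : ℝ) : EReal) < diamFrom (cluster H x) x}.indicator 1 H /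
    size ((cluster H x ∩ Metric.closedBall x (4 * r)) \ Metric.closedBall x r)

/-! ### The wired spanning forest with `o` wired to infinity -/

/-- The contraction of `G` in which `o` and all vertices outside the finite set `K` are identified
to one vertex `none`. -/
noncomputable def wire (o : V) (K : Finset V) : V → Option {v : V // v ∈ K ∧ v ≠ o} :=
  open Classical in fun v => if h : v ∈ K ∧ v ≠ o then some ⟨v, h⟩ else none

/-- The spanning trees of the wired graph in which `o` and all vertices outside `K` are identified
to one vertex. This is a multigraph whose edges are the edges of `G`; so a
spanning tree is a set of edges of `G` (viewed as a subgraph of `G` with all the vertices)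
that contains no loop and no two parallel edges of the wired graph, and that forms a tree on all
of its vertices. Equivalently, these are the spanning forests of the wired graph of `K`, in which
only the vertices outside `K` are identified to a sink `s`, that have exactly two components, one
containing `o` and the other containing `s`. -/
def wiredTrees (G : SimpleGraph V) (o : V) (K : Finset V) : Set G.Subgraph :=
  {H | H.verts = univ ∧
    (∀ e ∈ H.edgeSet, ¬ (Sym2.map (wire o K) e).IsDiag) ∧
    InjOn (Sym2.map (wire o K)) H.edgeSet ∧
    (SimpleGraph.fromEdgeSet (Sym2.map (wire o K) '' H.edgeSet)).IsTree}

/-- Cylinder events: those that depend on finitely many vertices and on the edges between them. -/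
def IsCylinder (A : Set G.Subgraph) : Prop :=
  ∃ F : Finset V, ∀ H H' : G.Subgraph,
    (∀ x ∈ F, x ∈ H.verts ↔ x ∈ H'.verts) →
    (∀ x ∈ F, ∀ y ∈ F, H.Adj x y ↔ H'.Adj x y) → (H ∈ A ↔ H' ∈ A)

/-- `μ` is the weak limit, as the finite set `K` increases to `V`, of the uniform measures on the
spanning trees of the wired graphs in which `o` is wired to the boundary. -/
def IsWiredLimit (G : SimpleGraph V) (o : V) (μ : Measure G.Subgraph) : Prop :=
  IsProbabilityMeasure μ ∧
    ∀ A : Set G.Subgraph, IsCylinder A →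
      Tendsto (fun K : Finset V => uniformOn (wiredTrees G o K) A) atTop (𝓝 (μ A))

/-- The measure `WSF_o`: the wired spanning forest with `o` wired to infinity. The limit is
unique, and it exists for every connected locally finite graph, by monotonicity. -/
noncomputable def wsfo (G : SimpleGraph V) (o : V) : Measure G.Subgraph :=
  open Classical in
  if h : ∃ μ : Measure G.Subgraph, IsWiredLimit G o μ then h.choose else 0

end Percolation

open Percolation

namespace Percolation

universe u

variable {V : Type u} {G : SimpleGraph V}

/-! Every part is one application of the mass transport principle: if `F` is diagonally invariant,
the expected mass leaving `o` equals the expected mass arriving at `o`. The principle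
(`mass_transport`) comes from integrating `F o (γ o) = F (γ⁻¹ o) o` over Haar measure. Left
invariance gives all fibres of `γ ↦ γ o` the same measure, and right invariance does so for `γ ↦ γ⁻¹
o`; that common value is positive and finite because the stabilizer of `o` is open and compact.

For (ii) and (iii), a vertex `x` whose cluster leaves the ball of radius `4r` spreads mass one
uniformly over the part of its cluster at distance in `(r, 4r]`. This set is nonempty since a path
cannot jump over the annulus (`exists_mem_annulus`), so `o` sends out exactly the indicator of the
event on the left, and the mass it receives is the sum on the right. The law may depend on the
sender as long as the family of laws is equivariant. For the wired forests this follows from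
uniqueness of weak limits (`wsfo_map`).

For (i), `x` sends `1 / |𝔗_x ∩ D_x(4r)|` to each `y` with `x` in the past of `y` and distance in
`(r, 2r]`. The senders to `o` lie within `4r` of each other in one tree, so `o` receives at most
one, and nothing unless its past reaches beyond `r`. Cauchy–Schwarz
(`sq_measure_univ_div_lintegral_le`) bounds the mass sent from below. -/

/-! ### Mass transport -/

/-- The vertices that are reached from `o` by walks of length at most `n`. -/
def graphBall (G : SimpleGraph V) (o : V) : ℕ → Set V
  | 0 => {o}
  | n + 1 => graphBall G o n ∪ ⋃ x ∈ graphBall G o n, G.neighborSet x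

theorem graphBall_finite (hfin : ∀ x : V, (G.neighborSet x).Finite) (o : V) (n : ℕ) :
    (graphBall G o n).Finite := by
  induction n with
  | zero => exact finite_singleton o
  | succ n ih => exact ih.union (ih.biUnion fun x _ => hfin x)

theorem mem_graphBall_self (o : V) (n : ℕ) : o ∈ graphBall G o n := by
  induction n with
  | zero => rfl
  | succ n ih => exact Or.inl ih

theorem graphBall_adj {o x y : V} {n : ℕ} (hx : x ∈ graphBall G o n) (h : G.Adj x y) :
    y ∈ graphBall G o (n + 1) :=
  Or.inr (mem_biUnion hx h)

theorem exists_mem_graphBall (hconn : G.Connected) (o x : V) : ∃ n, x ∈ graphBall G o n := by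
  obtain ⟨w⟩ := hconn.preconnected x o
  induction w with
  | nil => exact ⟨0, rfl⟩
  | cons h _ ih =>
    obtain ⟨n, hn⟩ := ih
    exact ⟨n + 1, graphBall_adj hn h.symm⟩

theorem map_mem_graphBall (γ : G ≃g G) {o x : V} {n : ℕ} (hx : x ∈ graphBall G o n) :
    γ x ∈ graphBall G (γ o) n := by
  induction n generalizing x with
  | zero => exact congrArg γ hx
  | succ n ih =>
    rcases hx with hx | hx
    · exact Or.inl (ih hx)
    · obtain ⟨y, hy, hyx⟩ := mem_iUnion₂.1 hx
      exact graphBall_adj (ih hy) ((γ.map_adj_iff).2 hyx)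

theorem countable_of_connected (hconn : G.Connected)
    (hfin : ∀ x : V, (G.neighborSet x).Finite) : Countable V := by
  obtain ⟨o⟩ := hconn.nonempty
  rw [← countable_univ_iff]
  refine (countable_iUnion fun n => (graphBall_finite hfin o n).countable).mono fun x _ => ?_
  exact mem_iUnion.2 (exists_mem_graphBall hconn o x)

section Topology

/-- The discrete topology on the vertex set, as a local instance. -/
local instance discreteVertices : TopologicalSpace V := ⊥

local instance : DiscreteTopology V := ⟨rfl⟩

theorem isInducing_coe (Γ : Subgroup (G ≃g G)) :
    IsInducing (fun γ : Γ => ((γ : G ≃g G) : V → V)) :=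
  IsInducing.comp (g := fun γ : G ≃g G => (γ : V → V)) ⟨rfl⟩ IsInducing.subtypeVal

/-- Haar invariance is used only through translation by one fixed element, so separate continuity of
the product is enough. -/
theorem continuous_mul_left_aut (Γ : Subgroup (G ≃g G)) (g : Γ) :
    Continuous fun γ : Γ => g * γ := by
  rw [(isInducing_coe Γ).continuous_iff]
  refine continuous_pi fun x => ?_
  have h := (continuous_apply x).comp (isInducing_coe Γ).continuous
  exact (continuous_of_discreteTopology (f := ((g : G ≃g G) : V → V))).comp h

theorem continuous_mul_right_aut (Γ : Subgroup (G ≃g G)) (g : Γ) :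
    Continuous fun γ : Γ => γ * g := by
  rw [(isInducing_coe Γ).continuous_iff]
  exact continuous_pi fun x =>
    (continuous_apply ((g : G ≃g G) x)).comp (isInducing_coe Γ).continuous

theorem isOpen_setOf_apply_mem (Γ : Subgroup (G ≃g G)) (x : V) (s : Set V) :
    IsOpen {γ : Γ | (γ : G ≃g G) x ∈ s} :=
  (isOpen_discrete s).preimage ((continuous_apply x).comp (isInducing_coe Γ).continuous)

/-- An automorphism fixing `o` preserves every ball about `o`, so the stabilizer embeds in a product
of finite sets, compact by Tychonoff. Its image is closed: a pointwise limit agrees on each finite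
set with some stabilizing element, hence is again an automorphism, and it lies in `Γ` because `Γ` is
closed. -/
theorem isCompact_stabilizer (hconn : G.Connected) (hfin : ∀ x : V, (G.neighborSet x).Finite)
    (Γ : Subgroup (G ≃g G)) (hclosed : IsClosed (Γ : Set (G ≃g G))) (o : V) :
    IsCompact {γ : Γ | (γ : G ≃g G) o = o} := by
  rw [(isInducing_coe Γ).isCompact_iff]
  set S := (fun γ : Γ => ((γ : G ≃g G) : V → V)) '' {γ : Γ | (γ : G ≃g G) o = o} with hS
  choose n hn using exists_mem_graphBall hconn o
  have hbox : IsCompact (Set.pi univ fun x => graphBall G o (n x)) :=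
    isCompact_univ_pi fun x => (graphBall_finite hfin o (n x)).isCompact
  refine hbox.of_isClosed_subset ?_ ?_
  · refine isClosed_of_closure_subset fun f hf => ?_
    have key : ∀ s : Set V, s.Finite →
        ∃ γ : Γ, (γ : G ≃g G) o = o ∧ ∀ x ∈ s, (γ : G ≃g G) x = f x := by
      intro s hs
      obtain ⟨g, hg, γ, hγ, rfl⟩ := mem_closure_iff.1 hf (s.pi fun x => {f x})
        (isOpen_set_pi hs fun _ _ => isOpen_discrete _) (fun x _ => rfl)
      exact ⟨γ, hγ, fun x hx => hg x hx⟩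
    have hinj : Function.Injective f := by
      intro x y hxy
      obtain ⟨γ, -, h⟩ := key {x, y} (by simp)
      apply (γ : G ≃g G).injective
      rw [h x (by simp), h y (by simp), hxy]
    have hadj : ∀ x y, G.Adj (f x) (f y) ↔ G.Adj x y := by
      intro x y
      obtain ⟨γ, -, h⟩ := key {x, y} (by simp)
      rw [← h x (by simp), ← h y (by simp)]
      exact (γ : G ≃g G).map_adj_iff
    -- The approximating `γ` depends on `y`, but it is taken to agree with `f` on a whole ball that
    -- contains `γ⁻¹ y`.
    have hsurj : Function.Surjective f := by
      intro y
      obtain ⟨γ, ho, h⟩ := key _ (graphBall_finite hfin o (n y))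
      have hmem : (γ : G ≃g G).symm y ∈ graphBall G o (n y) := by
        have := map_mem_graphBall (γ : G ≃g G).symm (hn y)
        rwa [show (γ : G ≃g G).symm o = o by
          rw [RelIso.symm_apply_eq]; exact ho.symm] at this
      exact ⟨_, by rw [← h _ hmem, RelIso.apply_symm_apply]⟩
    let φ : G ≃g G := ⟨Equiv.ofBijective f ⟨hinj, hsurj⟩, hadj _ _⟩
    have hφ : (φ : V → V) = f := rfl
    obtain ⟨C, hC, hCΓ⟩ := isClosed_induced_iff.1 hclosed
    have hSC : S ⊆ C := by
      rintro _ ⟨γ, -, rfl⟩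
      have : (γ : G ≃g G) ∈ (Γ : Set (G ≃g G)) := γ.2
      rwa [← hCΓ] at this
    have hφΓ : φ ∈ (Γ : Set (G ≃g G)) := by
      rw [← hCΓ]
      exact closure_minimal hSC hC hf
    refine ⟨⟨φ, hφΓ⟩, ?_, rfl⟩
    obtain ⟨γ, ho, h⟩ := key {o} (by simp)
    change f o = o
    rw [← h o rfl, ho]
  · rintro _ ⟨γ, hγ, rfl⟩ x -
    have := map_mem_graphBall (γ : G ≃g G) (hn x)
    rwa [show (γ : G ≃g G) o = o from hγ] at this

end Topology

/-- The mass transport principle for closed, transitive and unimodular groups of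
automorphisms. -/
theorem mass_transport (hconn : G.Connected) (hfin : ∀ x : V, (G.neighborSet x).Finite)
    (Γ : Subgroup (G ≃g G)) (hclosed : IsClosed (Γ : Set (G ≃g G)))
    (htrans : IsTransitive Γ) (hunim : IsUnimodularGroup Γ) (F : V → V → ℝ≥0∞)
    (hF : ∀ γ ∈ Γ, ∀ x y, F (γ x) (γ y) = F x y) (o : V) :
    ∑' x, F o x = ∑' x, F x o := by
  have : Countable V := countable_of_connected hconn hfin
  let : MeasurableSpace Γ := borel Γ
  have : BorelSpace Γ := ⟨rfl⟩
  let : MeasurableSpace V := ⊤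
  obtain ⟨ν, hν, hν'⟩ := hunim
  set c := ν {γ : Γ | (γ : G ≃g G) o = o} with hc
  have hopen : ∀ x s, IsOpen {γ : Γ | (γ : G ≃g G) x ∈ s} := isOpen_setOf_apply_mem Γ
  have hc0 : c ≠ 0 := (hopen o {o}).measure_ne_zero ν ⟨1, rfl⟩
  have hctop : c ≠ ∞ := (isCompact_stabilizer hconn hfin Γ hclosed o).measure_ne_top
  -- This set is a left coset of the stabilizer of `o`.
  have hleft : ∀ x, ν {γ : Γ | (γ : G ≃g G) o = x} = c := by
    intro x
    obtain ⟨g, hg, hgx⟩ := htrans o x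
    have hm : Measurable fun γ : Γ => (⟨g, hg⟩ : Γ) * γ :=
      (continuous_mul_left_aut Γ ⟨g, hg⟩).measurable
    rw [← map_mul_left_eq_self ν ⟨g, hg⟩]
    refine (Measure.map_apply hm (hopen o {x}).measurableSet).trans ?_
    rw [hc]
    congr 1
    ext γ
    change g ((γ : G ≃g G) o) = x ↔ (γ : G ≃g G) o = o
    rw [← hgx, g.injective.eq_iff]
  -- This set is a right coset of the same stabilizer; here unimodularity enters.
  have hright : ∀ x, ν {γ : Γ | (γ : G ≃g G) x = o} = c := by
    intro x
    obtain ⟨g, hg, hgx⟩ := htrans x o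
    have hm : Measurable fun γ : Γ => γ * (⟨g, hg⟩ : Γ) :=
      (continuous_mul_right_aut Γ ⟨g, hg⟩).measurable
    rw [← map_mul_right_eq_self ν ⟨g, hg⟩]
    refine (Measure.map_apply hm (hopen x {o}).measurableSet).trans ?_
    rw [hc]
    congr 1
    ext γ
    change (γ : G ≃g G) (g x) = o ↔ (γ : G ≃g G) o = o
    rw [hgx]
  have hsymm : ∀ x, (fun γ : Γ => (γ : G ≃g G).symm o) ⁻¹' {x} =
      {γ : Γ | (γ : G ≃g G) x ∈ ({o} : Set V)} := by
    intro x
    ext γ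
    exact (RelIso.symm_apply_eq (γ : G ≃g G)).trans eq_comm
  have hm1 : Measurable fun γ : Γ => (γ : G ≃g G) o :=
    fun s _ => (hopen o s).measurableSet
  have hm2 : Measurable fun γ : Γ => (γ : G ≃g G).symm o := by
    refine measurable_to_countable' fun x => ?_
    rw [hsymm]
    exact (hopen x {o}).measurableSet
  have h1 : ∫⁻ γ : Γ, F o ((γ : G ≃g G) o) ∂ν = (∑' x, F o x) * c := by
    rw [← lintegral_map (f := F o) measurable_from_top hm1, lintegral_countable',
      ← ENNReal.tsum_mul_right]
    refine tsum_congr fun x => ?_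
    rw [Measure.map_apply hm1 trivial, ← hleft x]
    rfl
  have h2 : ∫⁻ γ : Γ, F ((γ : G ≃g G).symm o) o ∂ν = (∑' x, F x o) * c := by
    rw [← lintegral_map (f := fun x => F x o) measurable_from_top hm2, lintegral_countable',
      ← ENNReal.tsum_mul_right]
    refine tsum_congr fun x => ?_
    rw [Measure.map_apply hm2 trivial, ← hright x, hsymm]
    rfl
  have h3 : ∀ γ : Γ, F o ((γ : G ≃g G) o) = F ((γ : G ≃g G).symm o) o := by
    intro γ
    rw [← hF γ γ.2 ((γ : G ≃g G).symm o) o, RelIso.apply_symm_apply]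
  simp only [h3] at h1
  rw [h1] at h2
  exact (ENNReal.mul_left_inj hc0 hctop).1 h2

/-! ### Measurability of cluster and past events -/

theorem measurableSet_mem_verts (x : V) : MeasurableSet {H : G.Subgraph | x ∈ H.verts} :=
  MeasurableSpace.measurableSet_generateFrom (Or.inl ⟨x, rfl⟩)

theorem measurableSet_adj (x y : V) : MeasurableSet {H : G.Subgraph | H.Adj x y} :=
  MeasurableSpace.measurableSet_generateFrom (Or.inr ⟨x, y, rfl⟩)

/-- Reachability is a countable union over walk lengths, and each length is handled by splitting off
the first edge. -/
theorem measurableSet_mem_cluster [Countable V] (x y : V) :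
    MeasurableSet {H : G.Subgraph | y ∈ cluster H x} := by
  have hwalk : ∀ (n : ℕ) (x : V),
      MeasurableSet {H : G.Subgraph | ∃ w : H.spanningCoe.Walk x y, w.length = n} := by
    intro n
    induction n with
    | zero =>
      intro x
      simp only [SimpleGraph.Walk.exists_length_eq_zero_iff]
      exact MeasurableSet.const _
    | succ n ih =>
      intro x
      have : {H : G.Subgraph | ∃ w : H.spanningCoe.Walk x y, w.length = n + 1} =
          ⋃ z, {H : G.Subgraph | H.Adj x z} ∩
            {H : G.Subgraph | ∃ w : H.spanningCoe.Walk z y, w.length = n} := by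
        ext H
        simp only [mem_iUnion, mem_inter_iff, mem_ofPred_eq]
        constructor
        · rintro ⟨w, hw⟩
          cases w with
          | nil => simp at hw
          | cons h w => exact ⟨_, h, w, by simpa using hw⟩
        · rintro ⟨z, h, w, hw⟩
          exact ⟨SimpleGraph.Walk.cons (G := H.spanningCoe) h w, congrArg (· + 1) hw⟩
      rw [this]
      exact MeasurableSet.iUnion fun z => (measurableSet_adj x z).inter (ih z)
  have : {H : G.Subgraph | y ∈ cluster H x} = {H : G.Subgraph | x ∈ H.verts} ∩
      ⋃ n, {H : G.Subgraph | ∃ w : H.spanningCoe.Walk x y, w.length = n} := by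
    ext H
    simp only [cluster, mem_ofPred_eq, mem_inter_iff, mem_iUnion]
    exact and_congr_right fun _ => ⟨fun ⟨w⟩ => ⟨_, w, rfl⟩, fun ⟨_, w, _⟩ => ⟨w⟩⟩
  rw [this]
  exact (measurableSet_mem_verts x).inter (MeasurableSet.iUnion fun n => hwalk n x)

theorem size_eq_tsum (A : Set V) : size A = ∑' y, A.indicator 1 y := by
  rw [size, ← ENNReal.tsum_set_one, tsum_subtype A (fun _ => (1 : ℝ≥0∞))]
  rfl

theorem measurable_size [Countable V] {S : G.Subgraph → Set V}
    (hS : ∀ y, MeasurableSet {H | y ∈ S H}) : Measurable fun H => size (S H) := by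
  simp only [size_eq_tsum]
  refine Measurable.tsum fun y => ?_
  exact (measurable_const (a := (1 : ℝ≥0∞))).indicator (hS y)

theorem lt_diamFrom_iff [MetricSpace V] {c : ℝ} {A : Set V} {x : V} :
    (c : EReal) < diamFrom A x ↔ ∃ v ∈ A, c < dist v x := by
  simp [diamFrom, lt_iSup_iff]

theorem measurableSet_lt_diamFrom [Countable V] [MetricSpace V] {S : G.Subgraph → Set V}
    (hS : ∀ y, MeasurableSet {H | y ∈ S H}) (c : ℝ) (x : V) :
    MeasurableSet {H | (c : EReal) < diamFrom (S H) x} := by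
  have : {H | (c : EReal) < diamFrom (S H) x} =
      ⋃ v, ⋃ _ : c < dist v x, {H | v ∈ S H} := by
    ext H
    simp [lt_diamFrom_iff, and_comm]
  rw [this]
  exact MeasurableSet.iUnion fun v => MeasurableSet.iUnion fun _ => hS v

theorem measurableSet_mem_inter {S : G.Subgraph → Set V}
    (hS : ∀ y, MeasurableSet {H | y ∈ S H}) (B : Set V) (y : V) :
    MeasurableSet {H | y ∈ S H ∩ B} :=
  (hS y).inter (MeasurableSet.const (y ∈ B))

theorem measurable_annulusRatio [Countable V] [MetricSpace V] (r : ℝ) (x : V) :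
    Measurable (annulusRatio r x : G.Subgraph → ℝ≥0∞) := by
  have hc := fun y => measurableSet_mem_cluster (G := G) x y
  refine Measurable.div ?_ (measurable_size ?_)
  · exact measurable_one.indicator (measurableSet_lt_diamFrom hc (4 * r) x)
  · exact measurableSet_mem_inter (measurableSet_mem_inter hc _) (Metric.closedBall x r)ᶜ

/-- The path `p` is self-avoiding and runs in `H` up to time `n`, starts at `y`, and visits `x`
at time `k`. -/
def IsPartialRay (H : G.Subgraph) (y x : V) (k n : ℕ) (p : ℕ → V) : Prop :=
  p 0 = y ∧ p k = x ∧ (∀ i ≤ n, ∀ j ≤ n, p i = p j → i = j) ∧ ∀ i < n, H.Adj (p i) (p (i + 1))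

/-- König's lemma: the partial rays, confined to the compact product of the balls about `y`, form a
decreasing sequence of nonempty closed sets. The horizon `n + k` keeps the visiting time `k` inside
the constrained range. -/
theorem exists_isRay_iff_forall_exists_isPartialRay
    (hfin : ∀ x : V, (G.neighborSet x).Finite) (H : G.Subgraph) (x y : V) (k : ℕ) :
    (∃ p, IsRay H p ∧ p 0 = y ∧ p k = x) ↔ ∀ n, ∃ p, IsPartialRay H y x k (n + k) p := by
  constructor
  · rintro ⟨p, hp, hy, hx⟩ n
    exact ⟨p, hy, hx, fun i _ j _ h => hp.1 h, fun i _ => hp.2 i⟩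
  intro h
  let : TopologicalSpace V := ⊥
  have : DiscreteTopology V := ⟨rfl⟩
  let S : ℕ → Set (ℕ → V) := fun n =>
    {p | IsPartialRay H y x k (n + k) p} ∩ univ.pi fun i => graphBall G y i
  have hbox : IsCompact (univ.pi fun i => graphBall G y i) :=
    isCompact_univ_pi fun i => (graphBall_finite hfin y i).isCompact
  have hev : ∀ (i : ℕ) (s : Set V), IsClosed {p : ℕ → V | p i ∈ s} := fun i s =>
    (isClosed_discrete s).preimage (continuous_apply i)
  have hev2 : ∀ (i j : ℕ) (P : V → V → Prop), IsClosed {p : ℕ → V | P (p i) (p j)} :=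
    fun i j P => IsClosed.preimage (f := fun p : ℕ → V => (p i, p j))
      ((continuous_apply i).prodMk (continuous_apply j)) (isClosed_discrete {q : V × V | P q.1 q.2})
  have hclosed : ∀ n, IsClosed (S n) := by
    intro n
    refine IsClosed.inter ?_ (isClosed_set_pi fun i _ => isClosed_discrete _)
    have hinj : IsClosed {p : ℕ → V | ∀ i ≤ n + k, ∀ j ≤ n + k, p i = p j → i = j} := by
      simp only [ofPred_forall]
      exact isClosed_iInter fun i => isClosed_iInter fun _ => isClosed_iInter fun j =>
        isClosed_iInter fun _ => hev2 i j fun a b => a = b → i = j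
    have hadj : IsClosed {p : ℕ → V | ∀ i < n + k, H.Adj (p i) (p (i + 1))} := by
      simp only [ofPred_forall]
      exact isClosed_iInter fun i => isClosed_iInter fun _ => hev2 i (i + 1) H.Adj
    exact (hev 0 {y}).inter ((hev k {x}).inter (hinj.inter hadj))
  have hne : ∀ n, (S n).Nonempty := by
    intro n
    obtain ⟨p, h0, hk, hinj, hadj⟩ := h n
    have hball : ∀ i ≤ n + k, p i ∈ graphBall G y i := by
      intro i
      induction i with
      | zero => exact fun _ => h0
      | succ i ih => exact fun hi => graphBall_adj (ih (by omega)) (hadj i (by omega)).adj_sub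
    -- Past the horizon the path is reset to `y`, which lies in every ball, so that it stays in the
    -- compact box.
    refine ⟨fun i => if i ≤ n + k then p i else y, ⟨by simpa using h0, by simpa using hk, ?_, ?_⟩,
      ?_⟩
    · intro i hi j hj
      simp only [hi, hj, if_true]
      exact hinj i hi j hj
    · intro i hi
      simp only [hi.le, Nat.succ_le_of_lt hi, if_true]
      exact hadj i hi
    · intro i _
      dsimp only
      split_ifs with hi
      · exact hball i hi
      · exact mem_graphBall_self y i
  have hanti : ∀ n, S (n + 1) ⊆ S n := fun n p ⟨⟨h0, hk, hinj, hadj⟩, hb⟩ =>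
    ⟨⟨h0, hk, fun i hi j hj => hinj i (by omega) j (by omega), fun i hi => hadj i (by omega)⟩, hb⟩
  obtain ⟨p, hp⟩ := IsCompact.nonempty_iInter_of_sequence_nonempty_isCompact_isClosed S hanti hne
    (hbox.of_isClosed_subset (hclosed 0) inter_subset_right) hclosed
  rw [mem_iInter] at hp
  refine ⟨p, ⟨fun i j hij => ?_, fun n => ?_⟩, (hp 0).1.1, (hp 0).1.2.1⟩
  · exact (hp (i + j)).1.2.2.1 i (by omega) j (by omega) hij
  · exact (hp (n + 1)).1.2.2.2 n (by omega)

theorem measurableSet_exists_isPartialRay [Countable V] (x y : V) (k n : ℕ) :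
    MeasurableSet {H : G.Subgraph | ∃ p, IsPartialRay H y x k (n + k) p} := by
  -- only the first `n + k + 1` vertices matter
  have : {H : G.Subgraph | ∃ p, IsPartialRay H y x k (n + k) p} =
      ⋃ q : Fin (n + k + 1) → V, {H : G.Subgraph | IsPartialRay H y x k (n + k)
        fun i => if h : i < n + k + 1 then q ⟨i, h⟩ else y} := by
    ext H
    simp only [mem_ofPred_eq, mem_iUnion]
    constructor
    · rintro ⟨p, h0, hk, hinj, hadj⟩
      refine ⟨fun i => p i, by simpa using h0, ?_, ?_, ?_⟩
      · simpa [show k < n + k + 1 by omega] using hk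
      · intro i hi j hj
        simpa [Nat.lt_succ_of_le hi, Nat.lt_succ_of_le hj] using hinj i hi j hj
      · intro i hi
        simpa [show i < n + k + 1 by omega, hi] using hadj i hi
    · rintro ⟨q, hq⟩
      exact ⟨_, hq⟩
  rw [this]
  refine MeasurableSet.iUnion fun q => ?_
  have hadj : ∀ p : ℕ → V, MeasurableSet {H : G.Subgraph | ∀ i < n + k, H.Adj (p i) (p (i + 1))} :=
    fun p => by
      simp only [ofPred_forall]
      exact MeasurableSet.iInter fun i => MeasurableSet.iInter fun _ => measurableSet_adj _ _
  exact (MeasurableSet.const _).inter ((MeasurableSet.const _).inter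
    ((MeasurableSet.const _).inter (hadj _)))

/-- There may be uncountably many rays; the compactness criterion replaces them by countable
operations on finite paths. -/
theorem measurableSet_mem_past [Countable V] (hfin : ∀ x : V, (G.neighborSet x).Finite)
    (x y : V) : MeasurableSet {H : G.Subgraph | y ∈ past H x} := by
  have : {H : G.Subgraph | y ∈ past H x} =
      ⋃ k, ⋂ n, {H : G.Subgraph | ∃ p, IsPartialRay H y x k (n + k) p} := by
    ext H
    simp only [mem_iUnion, mem_iInter, mem_ofPred_eq,
      ← exists_isRay_iff_forall_exists_isPartialRay hfin]
    exact ⟨fun ⟨p, hp, hy, k, hk⟩ => ⟨k, p, hp, hy, hk⟩,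
      fun ⟨k, p, hp, hy, hk⟩ => ⟨p, hp, hy, k, hk⟩⟩
  rw [this]
  exact MeasurableSet.iUnion fun k => MeasurableSet.iInter fun n =>
    measurableSet_exists_isPartialRay x y k n

/-! ### The action of automorphisms on subgraphs -/

theorem map_adj_apply (γ : G ≃g G) (H : G.Subgraph) (x y : V) :
    (H.map γ.toHom).Adj (γ x) (γ y) ↔ H.Adj x y := by
  constructor
  · rintro ⟨a, b, h, ha, hb⟩
    rwa [← γ.injective ha, ← γ.injective hb]
  · exact fun h => ⟨x, y, h, rfl, rfl⟩

theorem mem_verts_map_apply (γ : G ≃g G) (H : G.Subgraph) (x : V) :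
    γ x ∈ (H.map γ.toHom).verts ↔ x ∈ H.verts :=
  γ.injective.mem_set_image

theorem measurable_subgraph_map (γ : G ≃g G) : Measurable fun H : G.Subgraph => H.map γ.toHom := by
  refine measurable_generateFrom ?_
  rintro _ (⟨x, rfl⟩ | ⟨x, y, rfl⟩)
  · obtain ⟨x, rfl⟩ := γ.surjective x
    simp only [preimage_ofPred_eq, mem_verts_map_apply]
    exact measurableSet_mem_verts x
  · obtain ⟨x, rfl⟩ := γ.surjective x
    obtain ⟨y, rfl⟩ := γ.surjective y
    simp only [preimage_ofPred_eq, map_adj_apply]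
    exact measurableSet_adj x y

/-- The action of an automorphism on the space of subgraphs. -/
def subgraphEquiv (γ : G ≃g G) : G.Subgraph ≃ᵐ G.Subgraph where
  toFun H := H.map γ.toHom
  invFun H := H.map γ.symm.toHom
  left_inv H := by
    dsimp only
    rw [← SimpleGraph.Subgraph.map_comp]
    convert H.map_id
    ext x
    exact γ.symm_apply_apply x
  right_inv H := by
    dsimp only
    rw [← SimpleGraph.Subgraph.map_comp]
    convert H.map_id
    ext x
    exact γ.apply_symm_apply x
  measurable_toFun := measurable_subgraph_map γ
  measurable_invFun := measurable_subgraph_map γ.symm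

theorem subgraphEquiv_apply (γ : G ≃g G) (H : G.Subgraph) :
    subgraphEquiv γ H = H.map γ.toHom := rfl

theorem mem_cluster_map (γ : G ≃g G) (H : G.Subgraph) (x y : V) :
    γ y ∈ cluster (H.map γ.toHom) (γ x) ↔ y ∈ cluster H x := by
  let e : H.spanningCoe ≃g (H.map γ.toHom).spanningCoe := ⟨γ.toEquiv, map_adj_apply γ H _ _⟩
  exact and_congr (mem_verts_map_apply γ H x) (SimpleGraph.Iso.reachable_iff (φ := e))

theorem cluster_map (γ : G ≃g G) (H : G.Subgraph) (x : V) :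
    cluster (H.map γ.toHom) (γ x) = γ '' cluster H x := by
  ext y
  obtain ⟨y, rfl⟩ := γ.surjective y
  rw [mem_cluster_map, γ.injective.mem_set_image]

theorem mem_past_map (γ : G ≃g G) (H : G.Subgraph) (x y : V) :
    γ y ∈ past (H.map γ.toHom) (γ x) ↔ y ∈ past H x := by
  constructor
  · rintro ⟨p, ⟨hinj, hadj⟩, h0, k, hk⟩
    refine ⟨fun n => γ.symm (p n), ⟨γ.symm.injective.comp hinj, fun n => ?_⟩, ?_, k, ?_⟩
    · rw [← map_adj_apply γ, γ.apply_symm_apply, γ.apply_symm_apply]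
      exact hadj n
    · simp [h0]
    · simp [hk]
  · rintro ⟨p, ⟨hinj, hadj⟩, h0, k, hk⟩
    exact ⟨fun n => γ (p n), ⟨γ.injective.comp hinj, fun n => (map_adj_apply γ H _ _).2 (hadj n)⟩,
      congrArg γ h0, k, congrArg γ hk⟩

theorem size_image_of_injective {f : V → V} (hf : Function.Injective f) (A : Set V) :
    size (f '' A) = size A := by
  rw [size, size, hf.encard_image]

section Metric

variable [MetricSpace V]

theorem diamFrom_image {γ : G ≃g G} (hγ : ∀ x y, dist (γ x) (γ y) = dist x y) (A : Set V) (x : V) :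
    diamFrom (γ '' A) (γ x) = diamFrom A x := by
  simp only [diamFrom, iSup_image, hγ]

theorem closedBall_image {γ : G ≃g G} (hγ : ∀ x y, dist (γ x) (γ y) = dist x y) (x : V) (s : ℝ) :
    Metric.closedBall (γ x) s = γ '' Metric.closedBall x s := by
  ext y
  obtain ⟨y, rfl⟩ := γ.surjective y
  rw [γ.injective.mem_set_image, Metric.mem_closedBall, Metric.mem_closedBall, hγ]

theorem annulusRatio_map {γ : G ≃g G} (hγ : ∀ x y, dist (γ x) (γ y) = dist x y) (r : ℝ) (x : V)
    (H : G.Subgraph) : annulusRatio r (γ x) (H.map γ.toHom) = annulusRatio r x H := by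
  have h : (4 * r : ℝ) < diamFrom (cluster (H.map γ.toHom) (γ x)) (γ x) ↔
      (4 * r : ℝ) < diamFrom (cluster H x) x := by
    rw [cluster_map, diamFrom_image hγ]
  unfold annulusRatio
  congr 1
  · simp only [indicator_apply, mem_ofPred_eq, h, Pi.one_apply]
  · rw [cluster_map, closedBall_image hγ, closedBall_image hγ, ← image_inter γ.injective,
      ← image_sdiff γ.injective, size_image_of_injective γ.injective]

end Metric

/-! ### Two facts about lower Lebesgue integrals -/

/-- If `μ A = 0` both sides vanish, in agreement with the convention for conditioning on a null
event. -/
theorem measure_mul_lintegral_cond {α : Type*} [MeasurableSpace α] (μ : Measure α)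
    [IsFiniteMeasure μ] (A : Set α) (f : α → ℝ≥0∞) :
    μ A * ∫⁻ a, f a ∂(μ[|A]) = ∫⁻ a in A, f a ∂μ := by
  rw [ProbabilityTheory.cond, lintegral_smul_measure, smul_eq_mul, ← mul_assoc]
  by_cases h : μ A = 0
  · rw [h, Measure.restrict_eq_zero.2 h]
    simp
  · rw [ENNReal.mul_inv_cancel h (measure_ne_top μ A), one_mul]

/-- Cauchy–Schwarz for `f ^ (1/2)` and `f⁻¹ ^ (1/2)`, whose product is `1` almost everywhere once
`f` has finite integral. For an infinite integral the left side is `0`. -/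
theorem sq_measure_univ_div_lintegral_le {α : Type*} [MeasurableSpace α] (μ : Measure α)
    {f : α → ℝ≥0∞} (hf : Measurable f) (h0 : ∀ᵐ a ∂μ, f a ≠ 0) :
    μ univ ^ 2 / ∫⁻ a, f a ∂μ ≤ ∫⁻ a, (f a)⁻¹ ∂μ := by
  by_cases htop : ∫⁻ a, f a ∂μ = ∞
  · simp [htop]
  have hfin : ∀ᵐ a ∂μ, f a ≠ ∞ := (ae_lt_top hf htop).mono fun _ => ne_of_lt
  refine ENNReal.div_le_of_le_mul ?_
  have hsq : ∀ a : ℝ≥0∞, (a ^ (1 / 2 : ℝ)) ^ (2 : ℝ) = a := fun a => by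
    rw [← ENNReal.rpow_mul]
    norm_num
  have hμ : μ univ = ∫⁻ a, f a ^ (1 / 2 : ℝ) * (f a)⁻¹ ^ (1 / 2 : ℝ) ∂μ := by
    rw [← lintegral_one]
    refine lintegral_congr_ae ?_
    filter_upwards [h0, hfin] with a h0 hfin
    rw [← ENNReal.mul_rpow_of_nonneg _ _ (by norm_num), ENNReal.mul_inv_cancel h0 hfin,
      ENNReal.one_rpow]
  have h := ENNReal.lintegral_mul_le_Lp_mul_Lq μ Real.HolderConjugate.two_two
    (hf.pow_const (1 / 2 : ℝ)).aemeasurable (hf.inv.pow_const (1 / 2 : ℝ)).aemeasurable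
  simp only [Pi.mul_apply, Pi.inv_apply, hsq] at h
  rw [← hμ] at h
  calc μ univ ^ 2 = μ univ ^ (2 : ℝ) := by norm_cast
    _ ≤ _ := ENNReal.rpow_le_rpow h (by norm_num)
    _ = _ := by rw [ENNReal.mul_rpow_of_nonneg _ _ (by norm_num), hsq, hsq, mul_comm]

theorem indicator_one_congr {α β : Type*} {A : Set α} {B : Set β} {x : α} {y : β}
    (h : x ∈ A ↔ y ∈ B) :
    A.indicator (1 : α → ℝ≥0∞) x = B.indicator (1 : β → ℝ≥0∞) y := by
  by_cases hx : x ∈ A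
  · simp [hx, h.1 hx]
  · simp [hx, mt h.2 hx]

/-! ### Clusters that leave a large ball -/

/-- Along a path from `o` to a vertex beyond `4r`, the first vertex outside the ball of radius `r`
is still within `4r`, by the exit condition. -/
theorem exists_mem_annulus [MetricSpace V] {r : ℝ} (hr : 0 < r) {o : V}
    (hexit : ∀ x y : V, G.Adj x y → dist x o ≤ r → dist y o ≤ 4 * r) {H : G.Subgraph}
    (h : (4 * r : ℝ) < diamFrom (cluster H o) o) :
    ((cluster H o ∩ Metric.closedBall o (4 * r)) \ Metric.closedBall o r).Nonempty := by
  obtain ⟨v, ⟨ho, ⟨w⟩⟩, hv⟩ := lt_diamFrom_iff.1 h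
  have key : ∀ {x : V} (_ : H.spanningCoe.Walk x v), x ∈ cluster H o → dist x o ≤ r →
      ((cluster H o ∩ Metric.closedBall o (4 * r)) \ Metric.closedBall o r).Nonempty := by
    intro x w
    induction w with
    | nil => intro _ hx; linarith
    | @cons x y _ hxy w ih =>
      intro hx hxr
      have hy : y ∈ cluster H o := ⟨ho, hx.2.trans hxy.reachable⟩
      by_cases hyr : dist y o ≤ r
      · exact ih hv w hy hyr
      · exact ⟨y, ⟨hy, hexit x y (H.adj_sub hxy) hxr⟩, hyr⟩
  exact key w ⟨ho, SimpleGraph.Reachable.refl o⟩ (by simpa using hr.le)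

/-- The tail of the diameter of a cluster, for a family of measures on subgraphs, indexed by the
vertices, that is equivariant under a unimodular transitive group. -/
theorem measure_lt_diamFrom_cluster_eq_tsum [MetricSpace V]
    (hconn : G.Connected) (hfin : ∀ x : V, (G.neighborSet x).Finite)
    (Γ : Subgroup (G ≃g G)) (hclosed : IsClosed (Γ : Set (G ≃g G)))
    (htrans : IsTransitive Γ) (hunim : IsUnimodularGroup Γ)
    (hdist : ∀ γ ∈ Γ, ∀ x y : V, dist (γ x) (γ y) = dist x y)
    {o : V} {r : ℝ} (hr : 0 < r)
    (hexit : ∀ x y : V, G.Adj x y → dist x o ≤ r → dist y o ≤ 4 * r)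
    (M : V → Measure G.Subgraph) [∀ x, IsFiniteMeasure (M x)]
    (hM : ∀ γ ∈ Γ, ∀ x, (M x).map (fun H : G.Subgraph => H.map γ.toHom) = M (γ x))
    (hC : ∀ᵐ H ∂M o, (cluster H o ∩ Metric.closedBall o (4 * r)).Finite) :
    M o {H | ((4 * r : ℝ) : EReal) < diamFrom (cluster H o) o} =
      ∑' x : {x : V // r < dist x o ∧ dist x o ≤ 4 * r},
        M x {H | o ∈ cluster H x} *
          ∫⁻ H, annulusRatio r (x : V) H ∂((M x)[|{H | o ∈ cluster H x}]) := by
  have : Countable V := countable_of_connected hconn hfin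
  -- The mass sent from `x` to `y`; its expectation is taken under the sender's law `M x`.
  let f : V → V → G.Subgraph → ℝ≥0∞ := fun x y H =>
    ((cluster H x ∩ Metric.closedBall x (4 * r)) \ Metric.closedBall x r).indicator 1 y *
      annulusRatio r x H
  have hmeas : ∀ x y, MeasurableSet
      {H : G.Subgraph | y ∈ (cluster H x ∩ Metric.closedBall x (4 * r)) \
        Metric.closedBall x r} := fun x =>
    measurableSet_mem_inter (measurableSet_mem_inter (measurableSet_mem_cluster x) _)
      (Metric.closedBall x r)ᶜ
  have hf : ∀ x y, Measurable (f x y) := fun x y =>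
    ((measurable_const (a := (1 : ℝ≥0∞))).indicator (hmeas x y)).mul (measurable_annulusRatio r x)
  let F : V → V → ℝ≥0∞ := fun x y => ∫⁻ H, f x y H ∂M x
  have hF : ∀ γ ∈ Γ, ∀ x y, F (γ x) (γ y) = F x y := by
    intro γ hγ x y
    have hd := hdist γ hγ
    change ∫⁻ H, f (γ x) (γ y) H ∂M (γ x) = _
    rw [← hM γ hγ]
    refine (lintegral_map (hf _ _) (subgraphEquiv γ).measurable).trans
      (lintegral_congr fun H => ?_)
    rw [subgraphEquiv_apply]
    simp only [f]
    rw [annulusRatio_map hd, cluster_map, closedBall_image hd, closedBall_image hd,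
      ← image_inter γ.injective, ← image_sdiff γ.injective]
    rw [indicator_one_congr γ.injective.mem_set_image]
  have hmt := mass_transport hconn hfin Γ hclosed htrans hunim F hF o
  have hleft : ∑' y, F o y = M o {H | ((4 * r : ℝ) : EReal) < diamFrom (cluster H o) o} := by
    change ∑' y, ∫⁻ H, f o y H ∂M o = _
    rw [← lintegral_tsum fun y => (hf o y).aemeasurable,
      ← lintegral_indicator_one (measurableSet_lt_diamFrom (measurableSet_mem_cluster o) _ o)]
    refine lintegral_congr_ae ?_
    filter_upwards [hC] with H hH
    change ∑' y, _ * annulusRatio r o H = _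
    rw [ENNReal.tsum_mul_right, ← size_eq_tsum, annulusRatio]
    -- Cancelling the size of the annulus part needs it nonzero, by the exit condition, and finite,
    -- by `hC`.
    by_cases h : (4 * r : ℝ) < diamFrom (cluster H o) o
    · refine ENNReal.mul_div_cancel ?_ ?_
      · simpa [size, encard_eq_zero, nonempty_iff_ne_empty] using exists_mem_annulus hr hexit h
      · simpa [size] using hH.subset sdiff_subset
    · rw [indicator_of_notMem (show H ∉ _ from h)]
      simp
  have hright : ∀ x, F x o = {x : V | r < dist x o ∧ dist x o ≤ 4 * r}.indicator (fun x =>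
      M x {H | o ∈ cluster H x} *
        ∫⁻ H, annulusRatio r x H ∂((M x)[|{H | o ∈ cluster H x}])) x := by
    intro x
    by_cases hx : r < dist x o ∧ dist x o ≤ 4 * r
    · rw [indicator_of_mem (s := {x : V | r < dist x o ∧ dist x o ≤ 4 * r}) hx, measure_mul_lintegral_cond,
        ← lintegral_indicator (measurableSet_mem_cluster x o)]
      refine lintegral_congr fun H => ?_
      by_cases h : o ∈ cluster H x
      · simp [f, h, dist_comm o x, hx]
      · simp [f, h]
    · rw [indicator_of_notMem (s := {x : V | r < dist x o ∧ dist x o ≤ 4 * r}) hx]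
      have : ∀ H : G.Subgraph, f x o H = 0 := by
        intro H
        have : o ∉ (cluster H x ∩ Metric.closedBall x (4 * r)) \ Metric.closedBall x r := by
          rintro ⟨⟨-, h4⟩, h1⟩
          rw [Metric.mem_closedBall, dist_comm] at h4 h1
          exact hx ⟨not_le.1 h1, h4⟩
        simp [f, this]
      simp [F, this]
  rw [← hleft, hmt, tsum_congr hright, ← tsum_subtype]
  rfl

/-! ### The past of a vertex -/

theorem past_subset_reachable {H : G.Subgraph} {x y : V} (h : y ∈ past H x) :
    y ∈ H.verts ∧ H.spanningCoe.Reachable y x := by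
  obtain ⟨p, ⟨-, hadj⟩, rfl, k, rfl⟩ := h
  refine ⟨H.edge_vert (hadj 0), ?_⟩
  induction k with
  | zero => exact SimpleGraph.Reachable.refl _
  | succ k ih => exact ih.trans (SimpleGraph.Adj.reachable (G := H.spanningCoe) (hadj k))

theorem tsum_past_le_measure_lt_diamFrom_past [MetricSpace V]
    (hconn : G.Connected) (hfin : ∀ x : V, (G.neighborSet x).Finite)
    (Γ : Subgroup (G ≃g G)) (hclosed : IsClosed (Γ : Set (G ≃g G)))
    (htrans : IsTransitive Γ) (hunim : IsUnimodularGroup Γ)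
    (hdist : ∀ γ ∈ Γ, ∀ x y : V, dist (γ x) (γ y) = dist x y)
    {o : V} {r : ℝ} (hr : 0 < r) (μ : Measure G.Subgraph) (hμ : IsInvariant Γ μ) :
    ∑' x : {x : V // r < dist x o ∧ dist x o ≤ 2 * r},
        μ {H | o ∈ past H x} ^ 2 /
          ∫⁻ H, {H : G.Subgraph | o ∈ past H x}.indicator
            (fun H => size (cluster H o ∩ Metric.closedBall o (4 * r))) H ∂μ
      ≤ μ {H | (r : EReal) < diamFrom (past H o) o} := by
  have : Countable V := countable_of_connected hconn hfin
  let N : V → G.Subgraph → ℝ≥0∞ := fun x H => size (cluster H x ∩ Metric.closedBall x (4 * r))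
  have hN : ∀ x, Measurable (N x) := fun x =>
    measurable_size (measurableSet_mem_inter (measurableSet_mem_cluster x) _)
  let A : G.Subgraph → V → Set V := fun H x => past H x ∩ {y | r < dist y x ∧ dist y x ≤ 2 * r}
  have hA : ∀ x y, MeasurableSet {H : G.Subgraph | y ∈ A H x} := fun x =>
    measurableSet_mem_inter (measurableSet_mem_past hfin x) _
  -- The normalization uses the sender's own tree and ball, so that for a fixed sender it does not
  -- depend on the receiver.
  let f : V → V → G.Subgraph → ℝ≥0∞ := fun x y H => (A H y).indicator 1 x * (N x H)⁻¹
  have hf : ∀ x y, Measurable (f x y) := fun x y =>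
    ((measurable_const (a := (1 : ℝ≥0∞))).indicator (hA y x)).mul (hN x).inv
  let F : V → V → ℝ≥0∞ := fun x y => ∫⁻ H, f x y H ∂μ
  have hF : ∀ γ ∈ Γ, ∀ x y, F (γ x) (γ y) = F x y := by
    intro γ hγ x y
    have hd := hdist γ hγ
    change ∫⁻ H, f (γ x) (γ y) H ∂μ = _
    conv_lhs => rw [← hμ γ hγ]
    refine (lintegral_map (hf _ _) (subgraphEquiv γ).measurable).trans
      (lintegral_congr fun H => ?_)
    rw [subgraphEquiv_apply]
    have hNγ : N (γ x) (H.map γ.toHom) = N x H := by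
      change size _ = size _
      rw [cluster_map, closedBall_image hd, ← image_inter γ.injective,
        size_image_of_injective γ.injective]
    have hAγ : γ x ∈ A (H.map γ.toHom) (γ y) ↔ x ∈ A H y := by
      simp only [A, mem_inter_iff, mem_past_map, mem_ofPred_eq, hd]
    simp only [f, hNγ, indicator_one_congr hAγ]
  have hmt := mass_transport hconn hfin Γ hclosed htrans hunim F hF o
  have hright : ∑' x, F x o ≤ μ {H | (r : EReal) < diamFrom (past H o) o} := by
    change ∑' y, ∫⁻ H, f y o H ∂μ ≤ _
    rw [← lintegral_tsum fun y => (hf y o).aemeasurable,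
      ← lintegral_indicator_one (measurableSet_lt_diamFrom (measurableSet_mem_past hfin o) _ o)]
    refine lintegral_mono fun H => ?_
    -- Two points of `A H o` are within `2r` of `o`, hence within `4r` of each other, and are
    -- connected through `o`. So `A H o` is contained in the set counted by `N x H`.
    have hle : ∀ x, f x o H ≤ (A H o).indicator 1 x * (size (A H o))⁻¹ := by
      intro x
      by_cases hx : x ∈ A H o
      · have hxo := past_subset_reachable hx.1
        refine mul_le_mul_right (ENNReal.inv_le_inv.2 ?_) _
        refine ENat.toENNReal_le.2 (encard_le_encard fun z hz => ⟨⟨hxo.1, ?_⟩, ?_⟩)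
        · exact hxo.2.trans (past_subset_reachable hz.1).2.symm
        · have h1 := hx.2.2
          have h2 := hz.2.2
          have h3 := dist_triangle_right z x o
          rw [Metric.mem_closedBall]
          linarith
      · simp [f, hx]
    refine (ENNReal.tsum_le_tsum hle).trans ?_
    rw [ENNReal.tsum_mul_right, ← size_eq_tsum]
    by_cases hne : (A H o).Nonempty
    · obtain ⟨x, hx, hxr, -⟩ := hne
      rw [indicator_of_mem (s := {H : G.Subgraph | (r : EReal) < diamFrom (past H o) o})
        (lt_diamFrom_iff.2 ⟨x, hx, hxr⟩)]
      exact ENNReal.div_self_le_one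
    · simp [not_nonempty_iff_eq_empty.1 hne, size]
  refine le_trans ?_ hright
  rw [← hmt]
  refine (tsum_subtype {x : V | r < dist x o ∧ dist x o ≤ 2 * r} fun x : V =>
    μ {H | o ∈ past H x} ^ 2 / ∫⁻ H, {H : G.Subgraph | o ∈ past H x}.indicator
      (fun H => size (cluster H o ∩ Metric.closedBall o (4 * r))) H ∂μ).trans_le ?_
  refine ENNReal.tsum_le_tsum fun x => ?_
  by_cases hx : r < dist x o ∧ dist x o ≤ 2 * r
  · have hB := measurableSet_mem_past hfin x o
    rw [indicator_of_mem (s := {x : V | r < dist x o ∧ dist x o ≤ 2 * r}) hx, lintegral_indicator hB]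
    -- A vertex lying in some past is a vertex of `H`, so it is counted in its own cluster.
    have h0 : ∀ᵐ H ∂μ.restrict {H : G.Subgraph | o ∈ past H x}, N o H ≠ 0 := by
      refine (ae_restrict_iff' hB).2 (ae_of_all _ fun H hH => ?_)
      have ho : o ∈ cluster H o ∩ Metric.closedBall o (4 * r) :=
        ⟨⟨(past_subset_reachable hH).1, SimpleGraph.Reachable.refl o⟩, by simpa using hr.le⟩
      simpa [N, size, encard_eq_zero] using (nonempty_of_mem ho).ne_empty
    have h := sq_measure_univ_div_lintegral_le _ (hN o) h0
    rw [Measure.restrict_apply_univ] at h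
    refine h.trans_eq ?_
    rw [← lintegral_indicator hB]
    refine lintegral_congr fun H => ?_
    by_cases h : o ∈ past H x
    · simp [f, A, h, dist_comm o x, hx]
    · simp [f, A, h]
  · rw [indicator_of_notMem (s := {x : V | r < dist x o ∧ dist x o ≤ 2 * r}) hx]
    exact zero_le

/-! ### Equivariance of the wired spanning forest -/

/-- An automorphism maps the wired vertex set of `K` and `o` to that of their images. -/
def wireEquiv (γ : G ≃g G) (o : V) (K : Finset V) :
    Option {v : V // v ∈ K ∧ v ≠ o} ≃
      Option {v : V // v ∈ K.map γ.toEquiv.toEmbedding ∧ v ≠ γ o} :=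
  Equiv.optionCongr (γ.toEquiv.subtypeEquiv fun _ =>
    and_congr (Finset.mem_map' γ.toEquiv.toEmbedding).symm
      (not_congr γ.injective.eq_iff.symm))

theorem wire_map (γ : G ≃g G) (o : V) (K : Finset V) (v : V) :
    wire (γ o) (K.map γ.toEquiv.toEmbedding) (γ v) = wireEquiv γ o K (wire o K v) := by
  have h : (γ v ∈ K.map γ.toEquiv.toEmbedding ∧ γ v ≠ γ o) ↔ (v ∈ K ∧ v ≠ o) :=
    and_congr (Finset.mem_map' γ.toEquiv.toEmbedding) (not_congr γ.injective.eq_iff)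
  by_cases hv : v ∈ K ∧ v ≠ o
  · rw [wire, wire, dif_pos (h.2 hv), dif_pos hv]
    rfl
  · rw [wire, wire, dif_neg (mt h.1 hv), dif_neg hv]
    rfl

theorem sym2_wire_map (γ : G ≃g G) (o : V) (K : Finset V) (e : Sym2 V) :
    Sym2.map (wire (γ o) (K.map γ.toEquiv.toEmbedding)) (Sym2.map γ e) =
      Sym2.map (wireEquiv γ o K) (Sym2.map (wire o K) e) := by
  rw [Sym2.map_map, Sym2.map_map]
  congr 1
  exact funext (wire_map γ o K)

/-- The automorphism descends to a bijection of the wired vertex sets that commutes with the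
contraction, so each defining condition carries over separately. -/
theorem map_mem_wiredTrees_iff (γ : G ≃g G) (o : V) (K : Finset V) (H : G.Subgraph) :
    H.map γ.toHom ∈ wiredTrees G (γ o) (K.map γ.toEquiv.toEmbedding) ↔
      H ∈ wiredTrees G o K := by
  have hE : (H.map γ.toHom).edgeSet = Sym2.map γ '' H.edgeSet := H.edgeSet_map γ.toHom
  have hφ : Function.Injective (Sym2.map (wireEquiv γ o K)) :=
    Sym2.map.injective (wireEquiv γ o K).injective
  have himage : Sym2.map (wire (γ o) (K.map γ.toEquiv.toEmbedding)) '' (Sym2.map γ '' H.edgeSet) =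
      Sym2.map (wireEquiv γ o K) '' (Sym2.map (wire o K) '' H.edgeSet) := by
    simp only [image_image, sym2_wire_map]
  let e : SimpleGraph.fromEdgeSet (Sym2.map (wire o K) '' H.edgeSet) ≃g
      SimpleGraph.fromEdgeSet
        (Sym2.map (wireEquiv γ o K) '' (Sym2.map (wire o K) '' H.edgeSet)) :=
    ⟨wireEquiv γ o K, by
      intro a b
      rw [SimpleGraph.fromEdgeSet_adj, SimpleGraph.fromEdgeSet_adj, ← Sym2.map_mk,
        hφ.mem_set_image, (wireEquiv γ o K).injective.ne_iff]⟩
  unfold wiredTrees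
  simp only [mem_ofPred_eq, hE, himage]
  refine and_congr ?_ (and_congr ?_ (and_congr ?_ e.isTree_iff.symm))
  · change γ '' H.verts = univ ↔ _
    conv_lhs => rw [← image_univ_of_surjective γ.surjective, γ.injective.image_injective.eq_iff]
  · simp only [forall_mem_image, sym2_wire_map, Sym2.isDiag_map (wireEquiv γ o K).injective]
  · rw [InjOn, InjOn, forall_mem_image]
    simp only [forall_mem_image, sym2_wire_map, hφ.eq_iff,
      (Sym2.map.injective γ.injective).eq_iff]

/-- Counting measure is invariant under a measurable equivalence. The sets need not be measurable,
since the formula for the image measure under an equivalence holds for all sets. -/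
theorem uniformOn_preimage_measurableEquiv {α : Type*} [MeasurableSpace α] (e : α ≃ᵐ α)
    (S A : Set α) : uniformOn (e ⁻¹' S) (e ⁻¹' A) = uniformOn S A := by
  have hcount : (Measure.count : Measure α).map e = Measure.count := by
    ext s hs
    rw [e.map_apply, Measure.count_apply hs, Measure.count_apply (e.measurable hs),
      encard_preimage_of_bijective e.bijective]
  have h : ∀ s : Set α, Measure.count (e ⁻¹' s) = Measure.count s := fun s => by
    rw [← e.map_apply, hcount]
  rw [uniformOn, uniformOn, ProbabilityTheory.cond, ProbabilityTheory.cond,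
    Measure.smul_apply, Measure.smul_apply, h, ← e.map_apply, ← e.restrict_map, hcount]

theorem isCylinder_preimage {A : Set G.Subgraph} (hA : IsCylinder A) (γ : G ≃g G) :
    IsCylinder (subgraphEquiv γ ⁻¹' A) := by
  obtain ⟨F, hF⟩ := hA
  refine ⟨F.map γ.symm.toEquiv.toEmbedding, fun H H' hv he => hF _ _ ?_ ?_⟩
  · intro x hx
    obtain ⟨x, rfl⟩ := γ.surjective x
    rw [subgraphEquiv_apply, subgraphEquiv_apply, mem_verts_map_apply, mem_verts_map_apply]
    exact hv x (Finset.mem_map.2 ⟨γ x, hx, γ.symm_apply_apply x⟩)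
  · intro x hx y hy
    obtain ⟨x, rfl⟩ := γ.surjective x
    obtain ⟨y, rfl⟩ := γ.surjective y
    rw [subgraphEquiv_apply, subgraphEquiv_apply, map_adj_apply, map_adj_apply]
    exact he x (Finset.mem_map.2 ⟨γ x, hx, γ.symm_apply_apply x⟩) y
      (Finset.mem_map.2 ⟨γ y, hy, γ.symm_apply_apply y⟩)

/-- The approximation at `γ o` with `K` is the image of the one at `o` with `γ⁻¹ K`, and `K ↦ γ⁻¹ K`
tends to infinity along the finite sets. -/
theorem IsWiredLimit.map {o : V} {μ : Measure G.Subgraph} (h : IsWiredLimit G o μ)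
    (γ : G ≃g G) : IsWiredLimit G (γ o) (μ.map (subgraphEquiv γ)) := by
  obtain ⟨hμ, hlim⟩ := h
  refine ⟨Measure.isProbabilityMeasure_map (subgraphEquiv γ).measurable.aemeasurable,
    fun A hA => ?_⟩
  rw [MeasurableEquiv.map_apply]
  have hK : Tendsto (fun K : Finset V => K.map γ.symm.toEquiv.toEmbedding) atTop atTop := by
    refine tendsto_atTop_atTop_of_monotone (fun K L h => Finset.map_subset_map.2 h) fun K =>
      ⟨K.map γ.toEquiv.toEmbedding, fun x hx => ?_⟩
    exact Finset.mem_map.2 ⟨γ x, Finset.mem_map_of_mem _ hx, γ.symm_apply_apply x⟩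
  refine ((hlim _ (isCylinder_preimage hA γ)).comp hK).congr fun K => ?_
  rw [Function.comp_apply,
    ← uniformOn_preimage_measurableEquiv (subgraphEquiv γ) (wiredTrees G (γ o) K) A]
  congr 2
  ext H
  have hKK : (K.map γ.symm.toEquiv.toEmbedding).map γ.toEquiv.toEmbedding = K := by
    rw [Finset.map_map]
    convert Finset.map_refl
    ext x
    exact γ.apply_symm_apply x
  rw [← map_mem_wiredTrees_iff γ, hKK]
  rfl

theorem IsCylinder.inter {A B : Set G.Subgraph} (hA : IsCylinder A) (hB : IsCylinder B) :
    IsCylinder (A ∩ B) := by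
  classical
  obtain ⟨F, hF⟩ := hA
  obtain ⟨F', hF'⟩ := hB
  refine ⟨F ∪ F', fun H H' hv he => and_congr (hF H H' ?_ ?_) (hF' H H' ?_ ?_)⟩
  · exact fun x hx => hv x (Finset.mem_union_left _ hx)
  · exact fun x hx y hy => he x (Finset.mem_union_left _ hx) y (Finset.mem_union_left _ hy)
  · exact fun x hx => hv x (Finset.mem_union_right _ hx)
  · exact fun x hx y hy => he x (Finset.mem_union_right _ hx) y (Finset.mem_union_right _ hy)

/-- The measurable cylinder events form a π-system that generates the σ-algebra, and both measures
agree there by uniqueness of limits. -/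
theorem IsWiredLimit.unique {o : V} {μ ν : Measure G.Subgraph} (hμ : IsWiredLimit G o μ)
    (hν : IsWiredLimit G o ν) : μ = ν := by
  classical
  have := hμ.1
  have := hν.1
  have heq : ∀ A, IsCylinder A → μ A = ν A := fun A hA =>
    tendsto_nhds_unique (hμ.2 A hA) (hν.2 A hA)
  refine ext_of_generate_finite {A | MeasurableSet A ∧ IsCylinder A} ?_ ?_
    (fun A hA => heq A hA.2) (by simp)
  · refine le_antisymm ?_ (MeasurableSpace.generateFrom_le fun A hA => hA.1)
    refine MeasurableSpace.generateFrom_mono ?_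
    rintro _ (⟨x, rfl⟩ | ⟨x, y, rfl⟩)
    · exact ⟨measurableSet_mem_verts x, {x}, fun H H' hv _ => hv x (by simp)⟩
    · exact ⟨measurableSet_adj x y, {x, y}, fun H H' _ he => he x (by simp) y (by simp)⟩
  · exact fun A hA B hB _ => ⟨hA.1.inter hB.1, hA.2.inter hB.2⟩

theorem wsfo_eq {o : V} {μ : Measure G.Subgraph} (h : IsWiredLimit G o μ) : wsfo G o = μ := by
  have hex : ∃ μ : Measure G.Subgraph, IsWiredLimit G o μ := ⟨μ, h⟩
  rw [wsfo, dif_pos hex]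
  exact hex.choose_spec.unique h

/-- The default value `0` is taken only when no limit exists, so an event of probability one already
yields existence at `o`. -/
theorem isWiredLimit_wsfo_of_ne_zero {o : V} (h : wsfo G o ≠ 0) :
    IsWiredLimit G o (wsfo G o) := by
  by_cases hex : ∃ μ : Measure G.Subgraph, IsWiredLimit G o μ
  · obtain ⟨μ, hμ⟩ := hex
    rwa [wsfo_eq hμ]
  · exact absurd (by rw [wsfo, dif_neg hex]) h

theorem wsfo_map {o : V} (h : IsWiredLimit G o (wsfo G o)) (γ : G ≃g G) :
    (wsfo G o).map (fun H : G.Subgraph => H.map γ.toHom) = wsfo G (γ o) :=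
  (wsfo_eq (h.map γ)).symm

theorem measurableSet_cluster_finite [Countable V] (x : V) :
    MeasurableSet {H : G.Subgraph | (cluster H x).Finite} := by
  have : {H : G.Subgraph | (cluster H x).Finite} = {H | size (cluster H x) < ∞} := by
    ext H
    simp [size]
  rw [this]
  exact measurableSet_lt (measurable_size (measurableSet_mem_cluster x)) measurable_const

end Percolation

theorem theorem1p3 {V : Type*} [MetricSpace V] (G : SimpleGraph V)
    (hconn : G.Connected) (hfin : ∀ x : V, (G.neighborSet x).Finite)
    (Γ : Subgroup (G ≃g G)) (hclosed : IsClosed (Γ : Set (G ≃g G)))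
    (htrans : IsTransitive Γ) (hunim : IsUnimodularGroup Γ)
    (hdist : ∀ γ ∈ Γ, ∀ x y : V, dist (γ x) (γ y) = dist x y)
    (o : V) (r : ℝ) (hr : 0 < r) :
    -- (i)
    (∀ μ : Measure G.Subgraph, IsProbabilityMeasure μ → IsInvariant Γ μ →
      (∀ᵐ H ∂μ, IsOneEndedSpanningForest H) →
      ∑' x : {x : V // r < dist x o ∧ dist x o ≤ 2 * r},
          μ {H | o ∈ past H x} ^ 2 /
            ∫⁻ H, {H : G.Subgraph | o ∈ past H x}.indicator
              (fun H => size (cluster H o ∩ Metric.closedBall o (4 * r))) H ∂μ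
        ≤ μ {H | (r : EReal) < diamFrom (past H o) o}) ∧
    -- (ii)
    ((Metric.closedBall o (4 * r)).Finite →
      (∀ x y : V, G.Adj x y → dist x o ≤ r → dist y o ≤ 4 * r) →
      ∀ μ : Measure G.Subgraph, IsProbabilityMeasure μ → IsInvariant Γ μ →
        μ {H | ((4 * r : ℝ) : EReal) < diamFrom (cluster H o) o} =
          ∑' x : {x : V // r < dist x o ∧ dist x o ≤ 4 * r},
            μ {H | o ∈ cluster H x} *
              ∫⁻ H, annulusRatio r (x : V) H ∂(μ[|{H | o ∈ cluster H x}])) ∧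
    -- (iii)
    ((∀ x y : V, G.Adj x y → dist x o ≤ r → dist y o ≤ 4 * r) →
      wsfo G o {H | (cluster H o).Finite} = 1 →
        wsfo G o {H | ((4 * r : ℝ) : EReal) < diamFrom (cluster H o) o} =
          ∑' x : {x : V // r < dist x o ∧ dist x o ≤ 4 * r},
            wsfo G x {H | o ∈ cluster H x} *
              ∫⁻ H, annulusRatio r (x : V) H ∂((wsfo G x)[|{H | o ∈ cluster H x}])) := by
  refine ⟨fun μ _ hμ _ => tsum_past_le_measure_lt_diamFrom_past hconn hfin Γ hclosed htrans hunim
    hdist hr μ hμ, fun hball hexit μ _ hμ => ?_, fun hexit hwsf => ?_⟩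
  · exact measure_lt_diamFrom_cluster_eq_tsum hconn hfin Γ hclosed htrans hunim hdist hr hexit
      (fun _ => μ) (fun γ hγ _ => hμ γ hγ) (ae_of_all _ fun H => hball.subset inter_subset_right)
  · have : Countable V := countable_of_connected hconn hfin
    have ho : IsWiredLimit G o (wsfo G o) := isWiredLimit_wsfo_of_ne_zero fun h => by
      simp [h] at hwsf
    -- Transitivity carries existence of the limit from `o` to every vertex.
    have hlim : ∀ x, IsWiredLimit G x (wsfo G x) := fun x => by
      obtain ⟨γ, -, rfl⟩ := htrans o x
      rw [← wsfo_map ho]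
      exact ho.map γ
    have hprob : ∀ x, IsProbabilityMeasure (wsfo G x) := fun x => (hlim x).1
    refine measure_lt_diamFrom_cluster_eq_tsum hconn hfin Γ hclosed htrans hunim hdist hr hexit
      (wsfo G) (fun γ _ x => wsfo_map (hlim x) γ) ?_
    have hae : ∀ᵐ H ∂wsfo G o, (cluster H o).Finite :=
      (mem_ae_iff_prob_eq_one (measurableSet_cluster_finite o)).2 hwsf
    exact hae.mono fun H hH => hH.subset inter_subset_left
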